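/- For integers $m,n\ge 1$, $1\le \ell\le n$ and $1\le k\le m$ let $$M_{\ell,k}=\frac{k\binom mk\displaystyle\sum_{i_1=\ell}^{n}\cdots\sum_{i_{k-1}=\ell}^{n}\;\sum_{i_{k+1}=0}^{\ell-1}\cdots\sum_{i_m=0}^{\ell-1}\frac{\binom n{i_1}\cdots\binom n{i_{k-1}}\binom n{i_{k+1}}\cdots\binom n{i_m}}{\binom{mn}{i_1+\cdots+i_{k-1}+\ell+i_{k+1}+\cdots+i_m}}}{(mn+1)\,\mathrm B(\ell,n-\ell+1)},$$ where $\mathrm B$ is the Beta function. Let $F_{\ell:n}$ be the cumulative distribution function of the $\mathrm{Beta}(\ell,n-\ell+1)$ distribution, let $F_{\ell:n}^{-1}(p)=\inf\{x\in\mathbb R: F_{\ell:n}(x)\ge p\}$ for $p\in(0,1)$, and for $\alpha\in(0,1)$ let $$\tilde k_{m,n}(\ell,\alpha)=\left\lceil (m+\tfrac12)\,F_{\ell:n}(1-\alpha)+\tfrac12\right\rceil .$$ QQM returns a pair $(\ell^*,k^*)$ that minimizes $M_{\ell,k}$ over all $(\ell,k)\in\{1,\dots,n\}\times\{1,\dots,m\}$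 with $M_{\ell,k}\ge 1-\alpha$. QQM-Fast returns a pair $(\tilde\ell,\tilde k)$ where $\tilde\ell$ minimizes $F_{\ell:n}^{-1}\bigl(\tilde k_{m,n}(\ell,\alpha)/(m+\tfrac12)\bigr)$ over all $\ell\in\{1,\dots,n\}$ with $\tilde k_{m,n}(\ell,\alpha)\in\{1,\dots,m\}$, and $\tilde k=\tilde k_{m,n}(\tilde\ell,\alpha)$. **Theorem.** Let $m_0=18$ and $C=27$. For every $\alpha\in(0,1)$ there is an integer $n_0(\alpha)\ge 1$ such that, for all integers $n\ge n_0(\alpha)$ and $m\ge m_0$, both minimizations are over non-empty sets and have minimizers, and, for every choice of the minimizers $(\ell^*,k^*)$ and $\tilde\ell$, $$1-\alpha\;\le\; M_{\ell^*,k^*}\;\le\; M_{\tilde\ell,\tilde k}\;\le\; 1-\alpha+\frac{C}{(2m+1)\sqrt{n+2}} .$$ -/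

import Mathlib

open scoped BigOperators

noncomputable section

namespace QQ

/-- The number `M_{ℓ,k}` for `m` agents holding `n` calibration points each:
`k * C(m,k) * ∑ (C(n,i₁) ⋯ C(n,i_{k-1}) * C(n,i_{k+1}) ⋯ C(n,i_m)) / C(mn, i₁ + ⋯ + ℓ + ⋯ + i_m)`
divided by `(mn + 1) * B(ℓ, n - ℓ + 1)`, where the indices `i₁, …, i_{k-1}` (the function `a`) range
over `ℓ, …, n` and the indices `i_{k+1}, …, i_m` (the function `b`) range over `0, …, ℓ - 1`. -/
def M (m n ℓ k : ℕ) : ℝ :=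
  ((k : ℝ) * (m.choose k : ℝ) *
      ∑ a ∈ Fintype.piFinset (fun _ : Fin (k - 1) => Finset.Icc ℓ n),
        ∑ b ∈ Fintype.piFinset (fun _ : Fin (m - k) => Finset.range ℓ),
          ((∏ j, (n.choose (a j) : ℝ)) * ∏ j, (n.choose (b j) : ℝ)) /
            ((m * n).choose ((∑ j, a j) + ℓ + ∑ j, b j) : ℝ)) /
    (((m : ℝ) * (n : ℝ) + 1) * ProbabilityTheory.beta (ℓ : ℝ) ((n : ℝ) - (ℓ : ℝ) + 1))

/-- The cdf of the `ℓ`-th order statistic of `n` independent uniform variables on `[0,1]`,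
that is, of the `Beta(ℓ, n - ℓ + 1)` distribution. -/
def F (n ℓ : ℕ) (x : ℝ) : ℝ :=
  ProbabilityTheory.cdf
    (ProbabilityTheory.betaMeasure (ℓ : ℝ) ((n : ℝ) - (ℓ : ℝ) + 1)) x

/-- The quantile function of the `Beta(ℓ, n - ℓ + 1)` distribution
(generalized inverse of its cdf). -/
def Finv (n ℓ : ℕ) (p : ℝ) : ℝ :=
  sInf {x : ℝ | p ≤ F n ℓ x}

/-- `⌈(m + 1/2) F(1 - α) + 1/2⌉`, where `F` is the cdf of `Beta(ℓ, n - ℓ + 1)`. -/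
def kTilde (m n ℓ : ℕ) (α : ℝ) : ℕ :=
  ⌈((m : ℝ) + 1 / 2) * F n ℓ (1 - α) + 1 / 2⌉₊

/-- The pairs `(ℓ,k)` among which QQM minimizes `M_{ℓ,k}`. -/
def qqmCandidates (m n : ℕ) (α : ℝ) : Set (ℕ × ℕ) :=
  {p | p.1 ∈ Finset.Icc 1 n ∧ p.2 ∈ Finset.Icc 1 m ∧ 1 - α ≤ M m n p.1 p.2}

/-- `(ℓ,k)` is a possible output of QQM: an element of the argmin. -/
def IsQQM (m n : ℕ) (α : ℝ) (ℓ k : ℕ) : Prop :=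
  (ℓ, k) ∈ qqmCandidates m n α ∧
    IsMinOn (fun p : ℕ × ℕ => M m n p.1 p.2) (qqmCandidates m n α) (ℓ, k)

/-- The indices `ℓ` among which QQM-Fast minimizes. -/
def qqmFastCandidates (m n : ℕ) (α : ℝ) : Set ℕ :=
  {ℓ | ℓ ∈ Finset.Icc 1 n ∧ kTilde m n ℓ α ∈ Finset.Icc 1 m}

/-- `(ℓ,k)` is a possible output of QQM-Fast: `ℓ` belongs to the argmin and `k = kTilde ℓ`. -/
def IsQQMFast (m n : ℕ) (α : ℝ) (ℓ k : ℕ) : Prop :=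
  ℓ ∈ qqmFastCandidates m n α ∧
    IsMinOn (fun l : ℕ => Finv n l ((kTilde m n l α : ℝ) / ((m : ℝ) + 1 / 2)))
      (qqmFastCandidates m n α) ℓ ∧
    k = kTilde m n ℓ α

end QQ

end

open scoped BigOperators

namespace QQ

open Finset

/-! Write T for the cdf of Beta(ℓ, n-ℓ+1), which on (0,1) is a binomial tail. `M m n ℓ k` is the
mean of X, the k-th order statistic of m independent variables with cdf T, so V = T(X) is the k-th
order statistic of m uniforms. Two facts give computable bounds on this mean: log T is concave, and
E log V = -∑_{j=k}^m 1/j ≥ log((k-1/2)/(m+1/2)). Integrating the tangent to log T at c shows that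
T(c) ≤ (k-1/2)/(m+1/2) forces c ≤ M (`le_M`). Reflecting x ↦ 1-x shows that T(c) ≥ k/(m+1/2) forces
M ≤ c (`M_le`), hence M ≤ T⁻¹(k/(m+1/2)) (`M_le_Finv`).

Thus `kTilde` is the smallest k that the lower bound certifies, so every QQM-Fast candidate is a QQM
candidate. The QQM-Fast objective dominates M, so one ℓ with a small objective suffices. Put p =
1-α. The ceiling costs at most 3/2, so it is enough that T gains 3/(2m+1) between p and p +
27/((2m+1)√(n+2)). For ℓ = ⌊(n+1)p⌋, T(p) lies between 1/3 and 4/5, while Cantelli makes T small at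
distance of order 1/√n to the left of p. Log-concavity of 1-T carries this decay to the right of p
(`binomTail_increment`). -/

/-- The probability that a binomial variable with parameters `n` and `x` is at least `ℓ`. -/
def binomTail (n ℓ : ℕ) (x : ℝ) : ℝ :=
  ∑ i ∈ Icc ℓ n, (n.choose i : ℝ) * (x ^ i * (1 - x) ^ (n - i))

/-- The density of the `Beta(ℓ, n - ℓ + 1)` distribution on the unit interval. -/
def betaDens (n ℓ : ℕ) (x : ℝ) : ℝ :=
  (ℓ : ℝ) * (n.choose ℓ : ℝ) * (x ^ (ℓ - 1) * (1 - x) ^ (n - ℓ))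

/-! ### Binomial tails as functions of the success probability -/

lemma binomTail_of_lt {n ℓ : ℕ} (h : n < ℓ) (x : ℝ) : binomTail n ℓ x = 0 := by
  simp [binomTail, Finset.Icc_eq_empty_of_lt h]

lemma binomTail_succ {n ℓ : ℕ} (h : ℓ ≤ n) (x : ℝ) :
    binomTail n ℓ x
      = (n.choose ℓ : ℝ) * (x ^ ℓ * (1 - x) ^ (n - ℓ)) + binomTail n (ℓ + 1) x := by
  unfold binomTail
  rw [← Finset.insert_Icc_add_one_left_eq_Icc h, Finset.sum_insert (by simp)]

lemma continuous_binomTail (n ℓ : ℕ) : Continuous (binomTail n ℓ) := by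
  unfold binomTail; fun_prop

lemma continuous_betaDens (n ℓ : ℕ) : Continuous (betaDens n ℓ) := by
  unfold betaDens; fun_prop

/-- The derivatives of consecutive terms telescope. The recursion climbs in ℓ until ℓ > n, where the
tail vanishes. -/
lemma hasDerivAt_binomTail {n ℓ : ℕ} (hℓ : 1 ≤ ℓ) (x : ℝ) :
    HasDerivAt (binomTail n ℓ) (betaDens n ℓ x) x := by
  rcases lt_or_ge n ℓ with h | h
  · have : binomTail n ℓ = fun _ => 0 := funext (binomTail_of_lt h)
    rw [this]
    simpa [betaDens, Nat.choose_eq_zero_of_lt h] using hasDerivAt_const x (0 : ℝ)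
  · have ih := hasDerivAt_binomTail (n := n) (ℓ := ℓ + 1) (by omega) x
    have h1 : binomTail n ℓ = fun x => (n.choose ℓ : ℝ) * (x ^ ℓ * (1 - x) ^ (n - ℓ))
        + binomTail n (ℓ + 1) x := funext (binomTail_succ h)
    rw [h1]
    have h2 : HasDerivAt (fun x : ℝ => (1 - x) ^ (n - ℓ))
        (((n - ℓ : ℕ) : ℝ) * (1 - x) ^ (n - ℓ - 1) * (-1)) x := by
      simpa using ((hasDerivAt_id x).const_sub 1).fun_pow (n - ℓ)
    refine ((((hasDerivAt_pow ℓ x).mul h2).const_mul (n.choose ℓ : ℝ)).add ih).congr_deriv ?_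
    have h3 : ((n.choose (ℓ + 1) : ℝ)) * ((ℓ : ℝ) + 1) = n.choose ℓ * ((n - ℓ : ℕ) : ℝ) := by
      exact_mod_cast Nat.choose_succ_right_eq n ℓ
    simp only [betaDens, Nat.add_sub_cancel, Nat.sub_sub]
    push_cast
    linear_combination (x ^ ℓ * (1 - x) ^ (n - (ℓ + 1))) * h3
termination_by n + 1 - ℓ

lemma one_sub_binomTail {n ℓ : ℕ} (h : ℓ ≤ n + 1) (x : ℝ) :
    1 - binomTail n ℓ x = ∑ i ∈ range ℓ, (n.choose i : ℝ) * (x ^ i * (1 - x) ^ (n - i)) := by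
  have h1 : (1 : ℝ) = ∑ i ∈ range (n + 1), (n.choose i : ℝ) * (x ^ i * (1 - x) ^ (n - i)) := by
    have := add_pow x (1 - x) n
    rw [add_sub_cancel, one_pow] at this
    exact this.trans (Finset.sum_congr rfl fun i _ => by ring)
  have h2 := Finset.sum_range_add_sum_Ico
    (fun i => (n.choose i : ℝ) * (x ^ i * (1 - x) ^ (n - i))) h
  have h3 : Icc ℓ n = Ico ℓ (n + 1) := rfl
  rw [binomTail, h3, sub_eq_iff_eq_add, h2]
  exact h1

lemma binomTail_one_sub {n ℓ : ℕ} (h : ℓ ≤ n + 1) (x : ℝ) :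
    binomTail n (n + 1 - ℓ) (1 - x) = 1 - binomTail n ℓ x := by
  rw [one_sub_binomTail h, binomTail]
  refine Finset.sum_nbij' (fun i => n - i) (fun i => n - i) ?_ ?_ ?_ ?_ ?_
  · intro i hi; simp only [mem_Icc, mem_range] at *; omega
  · intro i hi; simp only [mem_Icc, mem_range] at *; omega
  · intro i hi; simp only [mem_Icc] at *; omega
  · intro i hi; simp only [mem_range] at *; omega
  · intro i hi
    simp only [mem_Icc] at hi
    rw [Nat.choose_symm hi.2, Nat.sub_sub_self hi.2]
    ring

lemma binomTail_zero {n ℓ : ℕ} (hℓ : 1 ≤ ℓ) : binomTail n ℓ 0 = 0 := by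
  refine Finset.sum_eq_zero fun i hi => ?_
  simp only [mem_Icc] at hi
  rw [zero_pow (by omega)]; simp

lemma binomTail_one {n ℓ : ℕ} (h : ℓ ≤ n) : binomTail n ℓ 1 = 1 := by
  have := binomTail_one_sub (n := n) (ℓ := ℓ) (by omega) 1
  rw [sub_self, binomTail_zero (by omega)] at this
  linarith

lemma betaDens_nonneg (n ℓ : ℕ) {x : ℝ} (h0 : 0 ≤ x) (h1 : x ≤ 1) : 0 ≤ betaDens n ℓ x := by
  have : 0 ≤ 1 - x := by linarith
  unfold betaDens; positivity

lemma betaDens_pos {n ℓ : ℕ} (hℓ : 1 ≤ ℓ) (h : ℓ ≤ n) {x : ℝ} (h0 : 0 < x) (h1 : x < 1) :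
    0 < betaDens n ℓ x := by
  have : 0 < 1 - x := by linarith
  have := Nat.choose_pos h
  unfold betaDens; positivity

lemma binomTail_nonneg (n ℓ : ℕ) {x : ℝ} (h0 : 0 ≤ x) (h1 : x ≤ 1) : 0 ≤ binomTail n ℓ x := by
  have : 0 ≤ 1 - x := by linarith
  unfold binomTail; positivity

lemma binomTail_pos {n ℓ : ℕ} (h : ℓ ≤ n) {x : ℝ} (h0 : 0 < x) (h1 : x < 1) :
    0 < binomTail n ℓ x := by
  rw [binomTail_succ h]
  have h2 := binomTail_nonneg n (ℓ + 1) h0.le h1.le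
  have : 0 < 1 - x := by linarith
  have := Nat.choose_pos h
  positivity

lemma binomTail_le_one {n ℓ : ℕ} (h : ℓ ≤ n) {x : ℝ} (h0 : 0 ≤ x) (h1 : x ≤ 1) :
    binomTail n ℓ x ≤ 1 := by
  have := binomTail_one_sub (n := n) (ℓ := ℓ) (by omega) x
  have := binomTail_nonneg n (n + 1 - ℓ) (x := 1 - x) (by linarith) (by linarith)
  linarith

lemma binomTail_lt_one {n ℓ : ℕ} (hℓ : 1 ≤ ℓ) (h : ℓ ≤ n) {x : ℝ} (h0 : 0 < x) (h1 : x < 1) :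
    binomTail n ℓ x < 1 := by
  have := binomTail_one_sub (n := n) (ℓ := ℓ) (by omega) x
  have := binomTail_pos (n := n) (ℓ := n + 1 - ℓ) (by omega) (x := 1 - x)
    (by linarith) (by linarith)
  linarith

lemma monotoneOn_binomTail {n ℓ : ℕ} (hℓ : 1 ≤ ℓ) :
    MonotoneOn (binomTail n ℓ) (Set.Icc 0 1) := by
  refine monotoneOn_of_hasDerivWithinAt_nonneg (convex_Icc 0 1)
    (continuous_binomTail n ℓ).continuousOn
    (fun x _ => (hasDerivAt_binomTail hℓ x).hasDerivWithinAt) fun x hx => ?_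
  rw [interior_Icc] at hx
  exact betaDens_nonneg n ℓ hx.1.le hx.2.le

lemma integral_betaDens {n ℓ : ℕ} (hℓ : 1 ≤ ℓ) (a b : ℝ) :
    ∫ x in a..b, betaDens n ℓ x = binomTail n ℓ b - binomTail n ℓ a :=
  intervalIntegral.integral_eq_sub_of_hasDerivAt (fun x _ => hasDerivAt_binomTail hℓ x)
    ((continuous_betaDens n ℓ).intervalIntegrable a b)

/-! ### Beta integrals and the cdf `F` -/

lemma integral_pow_mul_one_sub_pow {N a : ℕ} (h : a ≤ N) :
    ∫ x in (0 : ℝ)..1, x ^ a * (1 - x) ^ (N - a) = 1 / (((N : ℝ) + 1) * (N.choose a : ℝ)) := by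
  have h1 := integral_betaDens (n := N + 1) (ℓ := a + 1) (by omega) 0 1
  rw [binomTail_one (by omega), binomTail_zero (by omega), sub_zero] at h1
  simp only [betaDens, intervalIntegral.integral_const_mul, Nat.add_sub_cancel,
    Nat.add_sub_add_right] at h1
  have h2 : ((N : ℝ) + 1) * N.choose a = (N + 1).choose (a + 1) * ((a : ℝ) + 1) := by
    exact_mod_cast Nat.add_one_mul_choose_eq N a
  have h3 : (0 : ℝ) < N.choose a := by exact_mod_cast Nat.choose_pos h
  rw [eq_div_iff (by positivity), h2]
  push_cast at h1
  linear_combination h1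

lemma beta_natCast {n ℓ : ℕ} (hℓ : 1 ≤ ℓ) (h : ℓ ≤ n) :
    ProbabilityTheory.beta (ℓ : ℝ) ((n : ℝ) - (ℓ : ℝ) + 1) = 1 / ((ℓ : ℝ) * (n.choose ℓ : ℝ)) := by
  obtain ⟨d, rfl⟩ := Nat.exists_eq_add_of_le h
  obtain ⟨l, rfl⟩ := Nat.exists_eq_add_of_le' hℓ
  have e1 : ((l + 1 + d : ℕ) : ℝ) - ((l + 1 : ℕ) : ℝ) + 1 = (d : ℝ) + 1 := by push_cast; ring
  have e2 : ((l + 1 : ℕ) : ℝ) + ((d : ℝ) + 1) = ((l + 1 + d : ℕ) : ℝ) + 1 := by push_cast; ring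
  rw [ProbabilityTheory.beta, e1, e2, Nat.cast_succ l, Real.Gamma_nat_eq_factorial,
    Real.Gamma_nat_eq_factorial, Real.Gamma_nat_eq_factorial]
  have h1 : ((l + 1 + d).choose (l + 1) : ℝ) * ((l + 1).factorial : ℝ) * (d.factorial : ℝ)
      = ((l + 1 + d).factorial : ℝ) := by
    have := Nat.choose_mul_factorial_mul_factorial (n := l + 1 + d) (k := l + 1) (by omega)
    rw [Nat.add_sub_cancel_left] at this
    exact_mod_cast this
  have h2 : (0 : ℝ) < (l + 1 + d).choose (l + 1) := by
    exact_mod_cast Nat.choose_pos (by omega)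
  rw [div_eq_div_iff (by positivity) (by positivity), ← h1, Nat.factorial_succ]
  push_cast; ring

open MeasureTheory in
lemma betaPDF_eq_indicator {n ℓ : ℕ} (hℓ : 1 ≤ ℓ) (h : ℓ ≤ n) :
    ProbabilityTheory.betaPDF (ℓ : ℝ) ((n : ℝ) - (ℓ : ℝ) + 1)
      = (Set.Ioo (0 : ℝ) 1).indicator fun x => ENNReal.ofReal (betaDens n ℓ x) := by
  funext x
  rw [ProbabilityTheory.betaPDF_eq, Set.indicator_apply]
  split_ifs with h1 h2 h2
  · congr 1
    rw [beta_natCast hℓ h, one_div_one_div, betaDens, ← Real.rpow_natCast, ← Real.rpow_natCast,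
      Nat.cast_sub hℓ, Nat.cast_sub h, add_sub_cancel_right, Nat.cast_one, mul_assoc]
  · exact absurd h1 h2
  · exact absurd h2 h1
  · simp

open MeasureTheory in
lemma F_eq {n ℓ : ℕ} (hℓ : 1 ≤ ℓ) (h : ℓ ≤ n) (x : ℝ) :
    F n ℓ x = (∫⁻ y in Set.Ioo 0 1 ∩ Set.Iic x, ENNReal.ofReal (betaDens n ℓ y)).toReal := by
  have hp : IsProbabilityMeasure
      (ProbabilityTheory.betaMeasure (ℓ : ℝ) ((n : ℝ) - (ℓ : ℝ) + 1)) := by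
    have h' : (ℓ : ℝ) ≤ n := by exact_mod_cast h
    exact ProbabilityTheory.isProbabilityMeasureBeta (by exact_mod_cast hℓ) (by linarith)
  rw [F, ProbabilityTheory.cdf_eq_real, Measure.real, ProbabilityTheory.betaMeasure,
    withDensity_apply _ measurableSet_Iic, betaPDF_eq_indicator hℓ h,
    lintegral_indicator measurableSet_Ioo, Measure.restrict_restrict measurableSet_Ioo]

lemma F_of_nonpos {n ℓ : ℕ} (hℓ : 1 ≤ ℓ) (h : ℓ ≤ n) {x : ℝ} (hx : x ≤ 0) : F n ℓ x = 0 := by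
  have : Set.Ioo (0 : ℝ) 1 ∩ Set.Iic x = ∅ := by
    ext y
    simp only [Set.mem_inter_iff, Set.mem_Ioo, Set.mem_Iic, Set.mem_empty_iff_false, iff_false]
    rintro ⟨⟨h1, -⟩, h2⟩
    linarith
  rw [F_eq hℓ h, this]
  simp

open MeasureTheory in
lemma F_eq_binomTail {n ℓ : ℕ} (hℓ : 1 ≤ ℓ) (h : ℓ ≤ n) {x : ℝ} (hx : x ∈ Set.Ioo (0 : ℝ) 1) :
    F n ℓ x = binomTail n ℓ x := by
  have h1 : Set.Ioo (0 : ℝ) 1 ∩ Set.Iic x = Set.Ioc 0 x := by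
    ext y
    simp only [Set.mem_inter_iff, Set.mem_Ioo, Set.mem_Iic, Set.mem_Ioc]
    exact ⟨fun h => ⟨h.1.1, h.2⟩, fun h => ⟨⟨h.1, h.2.trans_lt hx.2⟩, h.2⟩⟩
  have h2 := integral_betaDens (n := n) hℓ 0 x
  rw [binomTail_zero hℓ, sub_zero, intervalIntegral.integral_of_le hx.1.le] at h2
  rw [F_eq hℓ h, h1, ← h2, ← integral_eq_lintegral_of_nonneg_ae]
  · filter_upwards [ae_restrict_mem measurableSet_Ioc] with y hy
    exact betaDens_nonneg n ℓ hy.1.le (hy.2.trans hx.2.le)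
  · exact (continuous_betaDens n ℓ).aestronglyMeasurable

/-! ### `M` as the mean of an order statistic -/

/-- `M` is the mean of the `k`-th order statistic of `m` independent variables with
distribution `Beta(ℓ, n - ℓ + 1)`. -/
lemma M_eq_integral {m n ℓ k : ℕ} (hℓ : 1 ≤ ℓ) (hn : ℓ ≤ n) (hk : 1 ≤ k) (hm : k ≤ m) :
    M m n ℓ k
      = ∫ x in (0 : ℝ)..1, x * (betaDens m k (binomTail n ℓ x) * betaDens n ℓ x) := by
  -- Expanding the powers T^(k-1) and (1-T)^(m-k) produces the multi-indices `a` and `b`. The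
  -- density supplies the middle index ℓ, its missing power of x coming from the factor x of the
  -- mean.
  have key : ∀ x : ℝ, x * (betaDens m k (binomTail n ℓ x) * betaDens n ℓ x)
      = (k : ℝ) * (m.choose k : ℝ) * ((ℓ : ℝ) * (n.choose ℓ : ℝ)) *
        ∑ a ∈ Fintype.piFinset (fun _ : Fin (k - 1) => Finset.Icc ℓ n),
        ∑ b ∈ Fintype.piFinset (fun _ : Fin (m - k) => Finset.range ℓ),
          ((∏ j, (n.choose (a j) : ℝ)) * ∏ j, (n.choose (b j) : ℝ)) *
            (x ^ ((∑ j, a j) + ℓ + ∑ j, b j)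
              * (1 - x) ^ (m * n - ((∑ j, a j) + ℓ + ∑ j, b j))) := by
    intro x
    simp only [betaDens]
    rw [one_sub_binomTail (by omega), binomTail, Finset.sum_pow', Finset.sum_pow',
      Finset.sum_mul_sum]
    simp only [Finset.mul_sum, Finset.sum_mul]
    refine Finset.sum_congr rfl fun a ha => Finset.sum_congr rfl fun b hb => ?_
    rw [Fintype.mem_piFinset] at ha hb
    have ha' : ∑ j, a j + ∑ j, (n - a j) = (k - 1) * n := by
      rw [← Finset.sum_add_distrib, Finset.sum_congr rfl fun j _ =>
        Nat.add_sub_cancel' (Finset.mem_Icc.1 (ha j)).2]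
      simp
    have hb' : ∑ j, b j + ∑ j, (n - b j) = (m - k) * n := by
      rw [← Finset.sum_add_distrib, Finset.sum_congr rfl fun j _ =>
        Nat.add_sub_cancel' (((Finset.mem_range.1 (hb j)).le).trans hn)]
      simp
    have hmn : m * n = (k - 1) * n + n + (m - k) * n := by
      obtain ⟨k, rfl⟩ := Nat.exists_eq_add_of_le' hk
      obtain ⟨d, rfl⟩ := Nat.exists_eq_add_of_le hm
      simp only [Nat.add_sub_cancel, Nat.add_sub_cancel_left]
      ring
    have hexp : m * n - ((∑ j, a j) + ℓ + ∑ j, b j)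
        = ∑ j, (n - a j) + ((n - ℓ) + ∑ j, (n - b j)) := by omega
    have hx : x ^ ℓ = x * x ^ (ℓ - 1) := by
      rw [← pow_succ', Nat.sub_add_cancel hℓ]
    simp only [hexp, Finset.prod_mul_distrib, Finset.prod_pow_eq_pow_sum, pow_add, hx]
    ring
  simp only [key]
  have hint : ∫ x in (0 : ℝ)..1, ∑ a ∈ Fintype.piFinset (fun _ : Fin (k - 1) => Finset.Icc ℓ n),
        ∑ b ∈ Fintype.piFinset (fun _ : Fin (m - k) => Finset.range ℓ),
          ((∏ j, (n.choose (a j) : ℝ)) * ∏ j, (n.choose (b j) : ℝ)) *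
            (x ^ ((∑ j, a j) + ℓ + ∑ j, b j)
              * (1 - x) ^ (m * n - ((∑ j, a j) + ℓ + ∑ j, b j)))
      = (∑ a ∈ Fintype.piFinset (fun _ : Fin (k - 1) => Finset.Icc ℓ n),
        ∑ b ∈ Fintype.piFinset (fun _ : Fin (m - k) => Finset.range ℓ),
          ((∏ j, (n.choose (a j) : ℝ)) * ∏ j, (n.choose (b j) : ℝ)) /
            ((m * n).choose ((∑ j, a j) + ℓ + ∑ j, b j) : ℝ)) / ((m : ℝ) * (n : ℝ) + 1) := by
    rw [intervalIntegral.integral_finsetSum fun a _ =>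
      Continuous.intervalIntegrable (by fun_prop) _ _, Finset.sum_div]
    refine Finset.sum_congr rfl fun a ha => ?_
    rw [intervalIntegral.integral_finsetSum fun b _ =>
      Continuous.intervalIntegrable (by fun_prop) _ _, Finset.sum_div]
    refine Finset.sum_congr rfl fun b hb => ?_
    rw [Fintype.mem_piFinset] at ha hb
    have ha' : ∑ j, a j ≤ (k - 1) * n := by
      simpa using Finset.sum_le_card_nsmul univ a n fun j _ => (Finset.mem_Icc.1 (ha j)).2
    have hb' : ∑ j, b j ≤ (m - k) * n := by
      simpa using Finset.sum_le_card_nsmul univ b n fun j _ =>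
        ((Finset.mem_range.1 (hb j)).le).trans hn
    have hmn : m * n = (k - 1) * n + n + (m - k) * n := by
      obtain ⟨k, rfl⟩ := Nat.exists_eq_add_of_le' hk
      obtain ⟨d, rfl⟩ := Nat.exists_eq_add_of_le hm
      simp only [Nat.add_sub_cancel, Nat.add_sub_cancel_left]
      ring
    rw [intervalIntegral.integral_const_mul, integral_pow_mul_one_sub_pow (by omega)]
    push_cast
    rw [mul_one_div, div_div, mul_comm ((m : ℝ) * n + 1)]
  rw [intervalIntegral.integral_const_mul, hint]
  simp only [M]
  rw [beta_natCast hℓ hn]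
  have hc : (0 : ℝ) < n.choose ℓ := by exact_mod_cast Nat.choose_pos hn
  have hℓ' : (0 : ℝ) < ℓ := by exact_mod_cast hℓ
  have hmn' : (0 : ℝ) < (m : ℝ) * n + 1 := by positivity
  field_simp

/-! ### Log-concavity of the beta cdf -/

/-- The inverse ratio is a nonnegative combination of the increasing functions x (x/(1-x))^d, where
d = i - ℓ, so the cross-multiplied inequality holds term by term. -/
lemma antitoneOn_betaDens_div_binomTail {n ℓ : ℕ} (hℓ : 1 ≤ ℓ) (h : ℓ ≤ n) :
    AntitoneOn (fun x => betaDens n ℓ x / binomTail n ℓ x) (Set.Ioo 0 1) := by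
  intro x hx y hy hxy
  have hc : (0 : ℝ) < n.choose ℓ := by exact_mod_cast Nat.choose_pos h
  have hy1 : 0 < 1 - y := by linarith [hy.2]
  have hx1 : 0 < 1 - x := by linarith [hx.2]
  have hx0 := hx.1
  have hy0 := hy.1
  have hℓ' : (0 : ℝ) < ℓ := by exact_mod_cast hℓ
  rw [div_le_div_iff₀ (binomTail_pos h hy.1 hy.2) (binomTail_pos h hx.1 hx.2)]
  simp only [betaDens, binomTail, Finset.mul_sum]
  refine Finset.sum_le_sum fun i hi => ?_
  obtain ⟨d, rfl⟩ := Nat.exists_eq_add_of_le (Finset.mem_Icc.1 hi).1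
  obtain ⟨e, rfl⟩ := Nat.exists_eq_add_of_le (Finset.mem_Icc.1 hi).2
  obtain ⟨l, rfl⟩ := Nat.exists_eq_add_of_le' hℓ
  have e1 : l + 1 + d + e - (l + 1) = d + e := by omega
  have e2 : l + 1 + d + e - (l + 1 + d) = e := by omega
  simp only [e1, e2, Nat.add_sub_cancel, pow_add, pow_one]
  have h1 : x * (x * (1 - y)) ^ d ≤ y * (y * (1 - x)) ^ d := by
    have : x * (1 - y) ≤ y * (1 - x) := by nlinarith
    gcongr
  rw [mul_pow, mul_pow] at h1
  have h2 := mul_le_mul_of_nonneg_left h1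
    (show 0 ≤ ((l + 1 : ℕ) : ℝ) * ((l + 1 + d + e).choose (l + 1)) *
      ((l + 1 + d + e).choose (l + 1 + d)) * (x ^ l * y ^ l * (1 - x) ^ e * (1 - y) ^ e) by
        positivity)
  convert h2 using 1 <;> ring

lemma hasDerivAt_log_binomTail {n ℓ : ℕ} (hℓ : 1 ≤ ℓ) (h : ℓ ≤ n) {x : ℝ}
    (hx : x ∈ Set.Ioo (0 : ℝ) 1) :
    HasDerivAt (fun x => Real.log (binomTail n ℓ x)) (betaDens n ℓ x / binomTail n ℓ x) x :=
  (hasDerivAt_binomTail hℓ x).log (binomTail_pos h hx.1 hx.2).ne'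

lemma concaveOn_log_binomTail {n ℓ : ℕ} (hℓ : 1 ≤ ℓ) (h : ℓ ≤ n) :
    ConcaveOn ℝ (Set.Ioo 0 1) fun x => Real.log (binomTail n ℓ x) := by
  refine AntitoneOn.concaveOn_of_deriv (convex_Ioo 0 1)
    (fun x hx => (hasDerivAt_log_binomTail hℓ h hx).continuousAt.continuousWithinAt) ?_ ?_
  · rw [interior_Ioo]
    exact fun x hx => (hasDerivAt_log_binomTail hℓ h hx).differentiableAt.differentiableWithinAt
  · rw [interior_Ioo]
    exact (antitoneOn_betaDens_div_binomTail hℓ h).congr fun x hx =>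
      (hasDerivAt_log_binomTail hℓ h hx).deriv.symm

lemma log_binomTail_le_tangent {n ℓ : ℕ} (hℓ : 1 ≤ ℓ) (h : ℓ ≤ n) {c x : ℝ}
    (hc : c ∈ Set.Ioo (0 : ℝ) 1) (hx : x ∈ Set.Ioo (0 : ℝ) 1) :
    Real.log (binomTail n ℓ x)
      ≤ Real.log (binomTail n ℓ c) + betaDens n ℓ c / binomTail n ℓ c * (x - c) := by
  have hcc := concaveOn_log_binomTail hℓ h
  have hd := hasDerivAt_log_binomTail hℓ h hc
  rcases lt_trichotomy x c with hxc | rfl | hxc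
  · have := hcc.le_slope_of_hasDerivAt hx hc hxc hd
    rw [slope_def_field, le_div_iff₀ (by linarith)] at this
    linarith
  · simp
  · have := hcc.slope_le_of_hasDerivAt hc hx hxc hd
    rw [slope_def_field, div_le_iff₀ (by linarith)] at this
    linarith

/-! ### The logarithmic mean and Jensen's inequality -/

/-- The mean of `log V` for `V` distributed as the `k`-th order statistic of `m` uniform
variables, with `V` written as the image of a `Beta(ℓ, n - ℓ + 1)` variable under its cdf. -/
lemma integral_betaDens_mul_log {m n ℓ k : ℕ} (hℓ : 1 ≤ ℓ) (hn : ℓ ≤ n) (hk : 1 ≤ k) :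
    IntervalIntegrable (fun x => betaDens m k (binomTail n ℓ x) * betaDens n ℓ x
        * Real.log (binomTail n ℓ x)) MeasureTheory.volume 0 1 ∧
    ∫ x in (0 : ℝ)..1, betaDens m k (binomTail n ℓ x) * betaDens n ℓ x
        * Real.log (binomTail n ℓ x) = -∑ j ∈ Icc k m, 1 / (j : ℝ) := by
  set T := binomTail n ℓ with hT
  -- An explicit antiderivative of minus the integrand: differentiating the sum cancels the term
  -- that comes from differentiating the logarithm.
  set h : ℝ → ℝ := fun x => ∑ j ∈ Icc k m, 1 / (j : ℝ) * binomTail m j (T x)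
    - binomTail m k (T x) * Real.log (T x) with hh
  have hTc : Continuous T := continuous_binomTail n ℓ
  have hcont : Continuous h := by
    -- Since k ≥ 1, a factor T can be pulled out of the tail; continuity at T = 0 then follows from
    -- that of t log t.
    have h1 : h = fun x => ∑ j ∈ Icc k m, 1 / (j : ℝ) * binomTail m j (T x)
        - (∑ i ∈ Icc k m, (m.choose i : ℝ) * (T x ^ (i - 1) * (1 - T x) ^ (m - i)))
          * (T x * Real.log (T x)) := by
      funext x
      simp only [hh, binomTail]
      congr 1
      rw [← mul_assoc]
      congr 1
      rw [Finset.sum_mul]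
      refine Finset.sum_congr rfl fun i hi => ?_
      have : T x ^ i = T x ^ (i - 1) * T x := by
        rw [← pow_succ, Nat.sub_add_cancel (hk.trans (Finset.mem_Icc.1 hi).1)]
      rw [this]; ring
    rw [h1]
    refine Continuous.sub (continuous_finsetSum _ fun j _ =>
      ((continuous_binomTail m j).comp hTc).const_mul _) ?_
    exact (Continuous.mul (by fun_prop) (Real.continuous_mul_log.comp hTc))
  have hder : ∀ x ∈ Set.Ioo (0 : ℝ) 1, HasDerivAt h
      (-(betaDens m k (T x) * betaDens n ℓ x * Real.log (T x))) x := by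
    intro x hx
    have hTx : 0 < T x := binomTail_pos hn hx.1 hx.2
    have hTd : HasDerivAt T (betaDens n ℓ x) x := hasDerivAt_binomTail hℓ x
    have h1 : HasDerivAt (fun x => ∑ j ∈ Icc k m, 1 / (j : ℝ) * binomTail m j (T x))
        (∑ j ∈ Icc k m, 1 / (j : ℝ) * (betaDens m j (T x) * betaDens n ℓ x)) x := by
      refine HasDerivAt.fun_sum fun j hj => ?_
      exact ((hasDerivAt_binomTail (hk.trans (Finset.mem_Icc.1 hj).1) (T x)).comp x hTd).const_mul _
    have h2 := ((hasDerivAt_binomTail (n := m) hk (T x)).comp x hTd).mul (hTd.log hTx.ne')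
    refine (h1.sub h2).congr_deriv ?_
    have h3 : ∑ j ∈ Icc k m, 1 / (j : ℝ) * (betaDens m j (T x) * betaDens n ℓ x)
        = binomTail m k (T x) * (betaDens n ℓ x / T x) := by
      rw [binomTail, Finset.sum_mul]
      refine Finset.sum_congr rfl fun j hj => ?_
      have hj1 : 1 ≤ j := hk.trans (Finset.mem_Icc.1 hj).1
      have hj0 : (0 : ℝ) < j := by exact_mod_cast hj1
      have : T x ^ j = T x ^ (j - 1) * T x := by
        rw [← pow_succ, Nat.sub_add_cancel hj1]
      rw [this, betaDens]
      field_simp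
    simp only [Function.comp_apply, h3]
    ring
  have hint : IntervalIntegrable
      (fun x => -(betaDens m k (T x) * betaDens n ℓ x * Real.log (T x)))
      MeasureTheory.volume 0 1 := by
    -- The logarithm may be unbounded at 0, but the derivative of `h` has constant sign, which
    -- yields integrability.
    refine intervalIntegral.intervalIntegrable_deriv_of_nonneg hcont.continuousOn
      (by simpa using hder) ?_
    intro x hx
    rw [min_eq_left zero_le_one, max_eq_right zero_le_one] at hx
    have hTx : 0 ≤ T x := binomTail_nonneg n ℓ hx.1.le hx.2.le
    have hTx1 : T x ≤ 1 := binomTail_le_one hn hx.1.le hx.2.le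
    have := Real.log_nonpos hTx hTx1
    have := mul_nonneg (betaDens_nonneg m k hTx hTx1) (betaDens_nonneg n ℓ hx.1.le hx.2.le)
    nlinarith
  refine ⟨by simpa [Pi.neg_def] using hint.neg, ?_⟩
  have hval := intervalIntegral.integral_eq_sub_of_hasDerivAt_of_le zero_le_one
    hcont.continuousOn hder hint
  have h0 : h 0 = 0 := by
    have hT0 : T 0 = 0 := binomTail_zero hℓ
    simp only [hh, hT0, Real.log_zero, mul_zero, sub_zero]
    exact Finset.sum_eq_zero fun j hj => by
      rw [binomTail_zero (hk.trans (Finset.mem_Icc.1 hj).1), mul_zero]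
  have h1 : h 1 = ∑ j ∈ Icc k m, 1 / (j : ℝ) := by
    have hT1 : T 1 = 1 := binomTail_one hn
    simp only [hh, hT1, Real.log_one, mul_zero, sub_zero]
    exact Finset.sum_congr rfl fun j hj => by
      rw [binomTail_one (Finset.mem_Icc.1 hj).2, mul_one]
  rw [intervalIntegral.integral_neg, h0, h1] at hval
  linarith

/-- This is log(1+u) ≥ 2u/(u+2) at u = 1/(x-1/2); the half-integer shifts make the bound telescope
when summed. -/
lemma one_div_le_log {x : ℝ} (hx : 1 ≤ x) :
    1 / x ≤ Real.log ((x + 1 / 2) / (x - 1 / 2)) := by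
  obtain ⟨y, rfl⟩ : ∃ y, x = y + 1 / 2 := ⟨x - 1 / 2, by ring⟩
  have hy : 0 < y := by linarith
  have h := Real.le_log_one_add_of_nonneg (x := 1 / y) (by positivity)
  have e1 : 1 + 1 / y = (y + 1 / 2 + 1 / 2) / (y + 1 / 2 - 1 / 2) := by
    rw [add_sub_cancel_right]; field_simp; ring
  have e2 : 2 * (1 / y) / (1 / y + 2) = 1 / (y + 1 / 2) := by
    field_simp; ring
  rwa [e1, e2] at h

lemma sum_one_div_le_log {k m : ℕ} (hk : 1 ≤ k) (hm : k ≤ m) :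
    ∑ j ∈ Icc k m, 1 / (j : ℝ) ≤ Real.log (((m : ℝ) + 1 / 2) / ((k : ℝ) - 1 / 2)) := by
  have hk' : (1 : ℝ) ≤ k := by exact_mod_cast hk
  induction m, hm using Nat.le_induction with
  | base => simpa using one_div_le_log hk'
  | succ m hm ih =>
    have hm' : (k : ℝ) ≤ m := by exact_mod_cast hm
    rw [Finset.sum_Icc_succ_top (by omega)]
    have := one_div_le_log (x := ((m + 1 : ℕ) : ℝ)) (by push_cast; linarith)
    have e : ((m + 1 : ℕ) : ℝ) - 1 / 2 = m + 1 / 2 := by push_cast; ring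
    rw [e, Real.log_div (by positivity) (by positivity)] at this
    rw [Real.log_div (by positivity) (by linarith)] at ih ⊢
    linarith

lemma integral_betaDens_comp {m n ℓ k : ℕ} (hℓ : 1 ≤ ℓ) (hn : ℓ ≤ n) (hk : 1 ≤ k) (hm : k ≤ m) :
    ∫ x in (0 : ℝ)..1, betaDens m k (binomTail n ℓ x) * betaDens n ℓ x = 1 := by
  have hc : Continuous fun x => betaDens m k (binomTail n ℓ x) * betaDens n ℓ x :=
    ((continuous_betaDens m k).comp (continuous_binomTail n ℓ)).mul (continuous_betaDens n ℓ)
  rw [intervalIntegral.integral_eq_sub_of_hasDerivAt (f := binomTail m k ∘ binomTail n ℓ)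
    (fun x _ => (hasDerivAt_binomTail hk _).comp x (hasDerivAt_binomTail hℓ x))
    (hc.intervalIntegrable 0 1)]
  simp [binomTail_one hn, binomTail_zero hℓ, binomTail_one hm, binomTail_zero hk]

/-- The tangent bound for log T at c, integrated against the law of the order statistic. -/
lemma neg_sum_le_log_binomTail_add {m n ℓ k : ℕ} (hℓ : 1 ≤ ℓ) (hn : ℓ ≤ n) (hk : 1 ≤ k)
    (hm : k ≤ m) {c : ℝ} (hc : c ∈ Set.Ioo (0 : ℝ) 1) :
    -∑ j ∈ Icc k m, 1 / (j : ℝ) ≤ Real.log (binomTail n ℓ c)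
      + betaDens n ℓ c / binomTail n ℓ c * (M m n ℓ k - c) := by
  obtain ⟨hint, hlog⟩ := integral_betaDens_mul_log (m := m) hℓ hn hk
  rw [← hlog, M_eq_integral hℓ hn hk hm]
  set s := betaDens n ℓ c / binomTail n ℓ c
  set g : ℝ → ℝ := fun x => betaDens m k (binomTail n ℓ x) * betaDens n ℓ x with hg
  have hgc : Continuous g :=
    ((continuous_betaDens m k).comp (continuous_binomTail n ℓ)).mul (continuous_betaDens n ℓ)
  have hg1 : ∫ x in (0 : ℝ)..1, g x = 1 := integral_betaDens_comp hℓ hn hk hm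
  have hr : ∫ x in (0 : ℝ)..1, ((Real.log (binomTail n ℓ c) - s * c) * g x + s * (x * g x))
      = Real.log (binomTail n ℓ c) + s * ((∫ x in (0 : ℝ)..1, x * g x) - c) := by
    rw [intervalIntegral.integral_add (Continuous.intervalIntegrable (by fun_prop) _ _)
      (Continuous.intervalIntegrable (by fun_prop) _ _), intervalIntegral.integral_const_mul,
      intervalIntegral.integral_const_mul, hg1]
    ring
  rw [← hr]
  refine intervalIntegral.integral_mono_on_of_le_Ioo zero_le_one hint
    (Continuous.intervalIntegrable (by fun_prop) _ _) fun x hx => ?_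
  have hg0 : 0 ≤ g x := mul_nonneg
    (betaDens_nonneg m k (binomTail_nonneg n ℓ hx.1.le hx.2.le)
      (binomTail_le_one hn hx.1.le hx.2.le)) (betaDens_nonneg n ℓ hx.1.le hx.2.le)
  have := mul_le_mul_of_nonneg_left (log_binomTail_le_tangent hℓ hn hc hx) hg0
  simp only [hg] at this ⊢
  linarith

/-- Lower bound for the mean of an order statistic, by Jensen's inequality for the log-concave
cdf of the beta distribution. -/
lemma le_M {m n ℓ k : ℕ} (hℓ : 1 ≤ ℓ) (hn : ℓ ≤ n) (hk : 1 ≤ k) (hm : k ≤ m) {c : ℝ}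
    (hc : c ∈ Set.Ioo (0 : ℝ) 1) (h : ((m : ℝ) + 1 / 2) * binomTail n ℓ c ≤ (k : ℝ) - 1 / 2) :
    c ≤ M m n ℓ k := by
  have h1 := neg_sum_le_log_binomTail_add hℓ hn hk hm hc
  have h2 := sum_one_div_le_log hk hm
  have hT := binomTail_pos hn hc.1 hc.2
  have hk' : (1 : ℝ) ≤ k := by exact_mod_cast hk
  have h3 : Real.log (binomTail n ℓ c)
      ≤ -Real.log (((m : ℝ) + 1 / 2) / ((k : ℝ) - 1 / 2)) := by
    rw [← Real.log_inv, inv_div]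
    refine Real.log_le_log hT ?_
    rw [le_div_iff₀ (by positivity)]
    linarith
  have hs : 0 < betaDens n ℓ c / binomTail n ℓ c := div_pos (betaDens_pos hℓ hn hc.1 hc.2) hT
  by_contra hcon
  push Not at hcon
  have := mul_neg_of_pos_of_neg hs (sub_neg.2 hcon)
  linarith

/-! ### Reflection and the upper bound -/

lemma betaDens_one_sub {n ℓ : ℕ} (hℓ : 1 ≤ ℓ) (hn : ℓ ≤ n) (x : ℝ) :
    betaDens n (n + 1 - ℓ) (1 - x) = betaDens n ℓ x := by
  have h1 := hasDerivAt_binomTail (n := n) hℓ x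
  have h2 : HasDerivAt (fun y => 1 - binomTail n (n + 1 - ℓ) (1 - y))
      (betaDens n (n + 1 - ℓ) (1 - x)) x := by
    simpa using ((hasDerivAt_binomTail (n := n) (ℓ := n + 1 - ℓ) (by omega) (1 - x)).comp_const_sub
      1 x).const_sub 1
  have h3 : (fun y => 1 - binomTail n (n + 1 - ℓ) (1 - y)) = binomTail n ℓ :=
    funext fun y => by rw [binomTail_one_sub (by omega), sub_sub_cancel]
  rw [h3] at h2
  exact h2.unique h1

/-- Under x ↦ 1-x, the k-th smallest of m variables becomes the k-th largest. -/
lemma M_symm {m n ℓ k : ℕ} (hℓ : 1 ≤ ℓ) (hn : ℓ ≤ n) (hk : 1 ≤ k) (hm : k ≤ m) :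
    M m n (n + 1 - ℓ) (m + 1 - k) = 1 - M m n ℓ k := by
  rw [M_eq_integral (by omega) (by omega) (by omega) (by omega), M_eq_integral hℓ hn hk hm]
  have hc : Continuous fun x => betaDens m k (binomTail n ℓ x) * betaDens n ℓ x :=
    ((continuous_betaDens m k).comp (continuous_binomTail n ℓ)).mul (continuous_betaDens n ℓ)
  have hsub : ∫ x in (0 : ℝ)..1, (1 - x) * (betaDens m k (binomTail n ℓ x) * betaDens n ℓ x)
      = 1 - ∫ x in (0 : ℝ)..1, x * (betaDens m k (binomTail n ℓ x) * betaDens n ℓ x) := by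
    simp only [sub_mul, one_mul]
    rw [intervalIntegral.integral_sub (hc.intervalIntegrable _ _)
      (Continuous.intervalIntegrable (by fun_prop) _ _), integral_betaDens_comp hℓ hn hk hm]
  have h := intervalIntegral.integral_comp_sub_left (a := 0) (b := 1) (fun x : ℝ => x *
    (betaDens m (m + 1 - k) (binomTail n (n + 1 - ℓ) x) * betaDens n (n + 1 - ℓ) x)) 1
  rw [sub_self, sub_zero] at h
  rw [← h, ← hsub]
  refine intervalIntegral.integral_congr fun x _ => ?_
  rw [binomTail_one_sub (by omega), betaDens_one_sub hk hm, betaDens_one_sub hℓ hn]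

/-- `le_M` at the reflected pair and 1-c. The threshold is k rather than k-1/2 because (m+1-k) - 1/2
= (m+1/2) - k. -/
lemma M_le {m n ℓ k : ℕ} (hℓ : 1 ≤ ℓ) (hn : ℓ ≤ n) (hk : 1 ≤ k) (hm : k ≤ m) {c : ℝ}
    (hc : c ∈ Set.Ioo (0 : ℝ) 1) (h : (k : ℝ) ≤ ((m : ℝ) + 1 / 2) * binomTail n ℓ c) :
    M m n ℓ k ≤ c := by
  have h1 := le_M (m := m) (n := n) (ℓ := n + 1 - ℓ) (k := m + 1 - k) (c := 1 - c) (by omega)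
    (by omega) (by omega) (by omega) ⟨by linarith [hc.2], by linarith [hc.1]⟩ (by
      rw [binomTail_one_sub (by omega), Nat.cast_sub (by omega)]
      push_cast
      linarith)
  rw [M_symm hℓ hn hk hm] at h1
  linarith

lemma M_le_one {m n ℓ k : ℕ} (hℓ : 1 ≤ ℓ) (hn : ℓ ≤ n) (hk : 1 ≤ k) (hm : k ≤ m) :
    M m n ℓ k ≤ 1 := by
  have h := M_symm hℓ hn hk hm
  have : 0 ≤ M m n (n + 1 - ℓ) (m + 1 - k) := by
    have h' : (0 : ℝ) < (n : ℝ) - ((n + 1 - ℓ : ℕ) : ℝ) + 1 := by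
      rw [Nat.cast_sub (by omega)]
      have : (1 : ℝ) ≤ ℓ := by exact_mod_cast hℓ
      push_cast
      linarith
    have := (ProbabilityTheory.beta_pos (α := ((n + 1 - ℓ : ℕ) : ℝ))
      (by exact_mod_cast (by omega : 0 < n + 1 - ℓ)) h').le
    unfold M
    positivity
  linarith

/-- Links the algorithms: the quantity minimized by QQM-Fast bounds the true mean. -/
lemma M_le_Finv {m n ℓ k : ℕ} (hℓ : 1 ≤ ℓ) (hn : ℓ ≤ n) (hk : 1 ≤ k) (hm : k ≤ m) :
    M m n ℓ k ≤ Finv n ℓ ((k : ℝ) / ((m : ℝ) + 1 / 2)) := by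
  have hlt : (k : ℝ) / ((m : ℝ) + 1 / 2) < 1 := by
    have : (k : ℝ) ≤ m := by exact_mod_cast hm
    rw [div_lt_one (by positivity)]
    linarith
  have hne : {x : ℝ | (k : ℝ) / ((m : ℝ) + 1 / 2) ≤ F n ℓ x}.Nonempty :=
    (((ProbabilityTheory.tendsto_cdf_atTop _).eventually (lt_mem_nhds hlt)).exists).imp
      fun _ h => h.le
  refine le_csInf hne fun x hx => ?_
  rw [Set.mem_ofPred_eq, div_le_iff₀ (by positivity)] at hx
  rcases le_or_gt x 0 with h0 | h0
  · rw [F_of_nonpos hℓ hn h0, zero_mul] at hx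
    have : (1 : ℝ) ≤ k := by exact_mod_cast hk
    linarith
  rcases le_or_gt 1 x with h1 | h1
  · exact (M_le_one hℓ hn hk hm).trans h1
  · rw [F_eq_binomTail hℓ hn ⟨h0, h1⟩, mul_comm] at hx
    exact M_le hℓ hn hk hm ⟨h0, h1⟩ hx

lemma Finv_le {n ℓ : ℕ} (hℓ : 1 ≤ ℓ) (hn : ℓ ≤ n) {q x : ℝ} (hq : 0 < q)
    (hx : x ∈ Set.Ioo (0 : ℝ) 1) (h : q ≤ binomTail n ℓ x) : Finv n ℓ q ≤ x := by
  refine csInf_le ⟨0, fun y hy => ?_⟩ ?_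
  · by_contra hcon
    rw [Set.mem_ofPred_eq, F_of_nonpos hℓ hn (not_le.1 hcon).le] at hy
    linarith
  · rwa [Set.mem_ofPred_eq, F_eq_binomTail hℓ hn hx]

/-! ### Tail bounds at and near the mean -/

lemma M_one_one {n ℓ : ℕ} (hℓ : 1 ≤ ℓ) (hn : ℓ ≤ n) : M 1 n ℓ 1 = (ℓ : ℝ) / ((n : ℝ) + 1) := by
  have hc : (0 : ℝ) < n.choose ℓ := by exact_mod_cast Nat.choose_pos hn
  have hℓ' : (0 : ℝ) < ℓ := by exact_mod_cast hℓ
  simp [M, beta_natCast hℓ hn]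
  field_simp

/-- The Jensen bound with m = k = 1 and c the mean: the linear term vanishes, leaving log T(c) ≥ -1
≥ -log 3. -/
lemma one_third_le_binomTail_mean {n ℓ : ℕ} (hℓ : 1 ≤ ℓ) (hn : ℓ ≤ n) :
    1 / 3 ≤ binomTail n ℓ ((ℓ : ℝ) / ((n : ℝ) + 1)) := by
  have hℓ' : (0 : ℝ) < ℓ := by exact_mod_cast hℓ
  have hn' : (ℓ : ℝ) ≤ n := by exact_mod_cast hn
  have hc : (ℓ : ℝ) / ((n : ℝ) + 1) ∈ Set.Ioo (0 : ℝ) 1 :=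
    ⟨by positivity, by rw [div_lt_one (by positivity)]; linarith⟩
  have h1 := neg_sum_le_log_binomTail_add (m := 1) hℓ hn le_rfl le_rfl hc
  have h2 := sum_one_div_le_log (k := 1) (m := 1) le_rfl le_rfl
  rw [M_one_one hℓ hn, sub_self, mul_zero, add_zero] at h1
  have h3 : ((1 : ℕ) + 1 / 2 : ℝ) / ((1 : ℕ) - 1 / 2) = (1 / 3)⁻¹ := by norm_num
  rw [h3, Real.log_inv] at h2
  exact (Real.log_le_log_iff (by norm_num) (binomTail_pos hn hc.1 hc.2)).1 (by linarith)

lemma binomTail_mean_le_two_thirds {n ℓ : ℕ} (hℓ : 1 ≤ ℓ) (hn : ℓ ≤ n) :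
    binomTail n ℓ ((ℓ : ℝ) / ((n : ℝ) + 1)) ≤ 2 / 3 := by
  have h1 := one_third_le_binomTail_mean (n := n) (ℓ := n + 1 - ℓ) (by omega) (by omega)
  have e : ((n + 1 - ℓ : ℕ) : ℝ) / ((n : ℝ) + 1) = 1 - (ℓ : ℝ) / ((n : ℝ) + 1) := by
    rw [Nat.cast_sub (by omega)]
    have : (n : ℝ) + 1 ≠ 0 := by positivity
    push_cast
    field_simp
  rw [e, binomTail_one_sub (by omega)] at h1
  linarith

/-- Cantelli's inequality for the binomial distribution. -/
lemma binomTail_cantelli {n ℓ : ℕ} {x t : ℝ} (hx : x ∈ Set.Icc (0 : ℝ) 1)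
    (ht : 0 ≤ t) (h : (n : ℝ) * x + t ≤ ℓ) :
    ((n : ℝ) / 4 + t ^ 2) * binomTail n ℓ x ≤ (n : ℝ) / 4 := by
  set w : ℕ → ℝ := fun i => (n.choose i : ℝ) * (x ^ i * (1 - x) ^ (n - i)) with hw
  have hx1 : 0 ≤ 1 - x := by linarith [hx.2]
  have hx0 := hx.1
  have hw0 : ∀ i, 0 ≤ w i := fun i => by simp only [hw]; positivity
  have heval : ∀ i, (bernsteinPolynomial ℝ n i).eval x = w i := fun i => by
    simp [bernsteinPolynomial, hw, mul_assoc]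
  have m0 : ∑ i ∈ range (n + 1), w i = 1 := by
    have := congrArg (Polynomial.eval x) (bernsteinPolynomial.sum ℝ n)
    simpa [Polynomial.eval_finsetSum, heval] using this
  have m1 : ∑ i ∈ range (n + 1), (i : ℝ) * w i = n * x := by
    have := congrArg (Polynomial.eval x) (bernsteinPolynomial.sum_smul ℝ n)
    simpa [Polynomial.eval_finsetSum, heval] using this
  have m2 : ∑ i ∈ range (n + 1), ((n : ℝ) * x - i) ^ 2 * w i = n * x * (1 - x) := by
    have := congrArg (Polynomial.eval x) (bernsteinPolynomial.variance ℝ n)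
    simpa [Polynomial.eval_finsetSum, heval] using this
  set v : ℝ := (n : ℝ) / 4 with hv
  have hv0 : 0 ≤ v := by positivity
  have hvar : (n : ℝ) * x * (1 - x) ≤ v := by
    have : (0 : ℝ) ≤ n := by positivity
    nlinarith [mul_nonneg this (sq_nonneg (x - 1 / 2))]
  -- The quadratic weight of Cantelli's proof, with `v` = n/4 in place of the variance. It is at
  -- least (v+t²)² for i ≥ ℓ, and its mean is at most v(v+t²).
  have htot : ∑ i ∈ range (n + 1), (t * (i - n * x) + v) ^ 2 * w i
      = t ^ 2 * (n * x * (1 - x)) + v ^ 2 := by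
    have : ∀ i : ℕ, (t * (i - n * x) + v) ^ 2 * w i
        = t ^ 2 * (((n : ℝ) * x - i) ^ 2 * w i) + 2 * t * v * (i * w i)
          + (v ^ 2 - 2 * t * v * (n * x)) * w i := fun i => by ring
    simp only [this, Finset.sum_add_distrib, ← Finset.mul_sum, m0, m1, m2]
    ring
  have hlow : (v + t ^ 2) ^ 2 * binomTail n ℓ x
      ≤ ∑ i ∈ range (n + 1), (t * (i - n * x) + v) ^ 2 * w i := by
    rw [binomTail, Finset.mul_sum]
    refine (Finset.sum_le_sum fun i hi => ?_).trans
      (Finset.sum_le_sum_of_subset_of_nonneg (s := Icc ℓ n) (fun i hi => ?_) fun i _ _ => ?_)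
    · have hi' : (ℓ : ℝ) ≤ i := by exact_mod_cast (Finset.mem_Icc.1 hi).1
      refine mul_le_mul_of_nonneg_right ?_ (hw0 i)
      refine pow_le_pow_left₀ (by positivity) ?_ 2
      nlinarith
    · simp only [mem_Icc, mem_range] at *; omega
    · exact mul_nonneg (sq_nonneg _) (hw0 i)
  rcases eq_or_lt_of_le (show 0 ≤ v + t ^ 2 by positivity) with h0 | h0
  · rw [← h0, zero_mul]; exact hv0
  · refine le_of_mul_le_mul_left ?_ h0
    nlinarith [mul_le_mul_of_nonneg_left hvar (sq_nonneg t)]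

lemma binom_pmf_succ_le {n j : ℕ} {p : ℝ} (hp : p ∈ Set.Ioo (0 : ℝ) 1) (hj : j + 1 ≤ n)
    (h : 9 / 10 * (((n : ℝ) - j) * p) ≤ ((j : ℝ) + 1) * (1 - p)) :
    9 / 10 * ((n.choose (j + 1) : ℝ) * (p ^ (j + 1) * (1 - p) ^ (n - (j + 1))))
      ≤ (n.choose j : ℝ) * (p ^ j * (1 - p) ^ (n - j)) := by
  have h3 : ((n.choose (j + 1) : ℝ)) * ((j : ℝ) + 1) = n.choose j * ((n : ℝ) - j) := by
    have := Nat.choose_succ_right_eq n j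
    rw [← Nat.cast_sub (by omega)]
    exact_mod_cast this
  have hq : 0 < 1 - p := by linarith [hp.2]
  have hp0 := hp.1
  have e : n - j = n - (j + 1) + 1 := by omega
  refine le_of_mul_le_mul_left ?_ (show (0 : ℝ) < j + 1 by positivity)
  rw [e, pow_succ, pow_succ]
  have := mul_le_mul_of_nonneg_left h
    (show 0 ≤ (n.choose j : ℝ) * (p ^ j * (1 - p) ^ (n - (j + 1))) by positivity)
  linear_combination this + 9 / 10 * p ^ j * p * (1 - p) ^ (n - (j + 1)) * h3

/-- Since (ℓ+1)/(n+1) > p, the tail from ℓ+1 is at most 2/3. The mass w at ℓ is controlled by its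
two left neighbours, at least 0.9w and 0.81w: 2.71w fits into what that tail leaves of 1. The bound
20 secures both ratios. -/
lemma binomTail_le_four_fifths {n ℓ : ℕ} {p : ℝ} (hp : p ∈ Set.Ioo (0 : ℝ) 1) (h2 : 2 ≤ ℓ)
    (hn : ℓ + 1 ≤ n) (hℓ1 : ((n : ℝ) + 1) * p - 1 < ℓ)
    (hbig : 20 ≤ ((n : ℝ) + 1) * (p * (1 - p))) :
    binomTail n ℓ p ≤ 4 / 5 := by
  obtain ⟨j, rfl⟩ := Nat.exists_eq_add_of_le' h2
  have hq : 0 < 1 - p := by linarith [hp.2]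
  have hp0 := hp.1
  push_cast at hℓ1
  have e1 := mul_lt_mul_of_pos_right hℓ1 hq
  have r1 := binom_pmf_succ_le (n := n) (j := j + 1) hp (by omega) (by
    push_cast; nlinarith)
  have r2 := binom_pmf_succ_le (n := n) (j := j) hp (by omega) (by nlinarith)
  have t0 := binomTail_succ (n := n) (ℓ := j) (by omega) p
  have t1 := binomTail_succ (n := n) (ℓ := j + 1) (by omega) p
  have t2 := binomTail_succ (n := n) (ℓ := j + 2) (by omega) p
  have hle := binomTail_le_one (n := n) (ℓ := j) (by omega) hp.1.le hp.2.le
  have hmean : binomTail n (j + 3) p ≤ 2 / 3 := by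
    have hj : ((j + 3 : ℕ) : ℝ) ≤ n := by exact_mod_cast hn
    refine (monotoneOn_binomTail (by omega) ⟨hp.1.le, hp.2.le⟩ ⟨by positivity, ?_⟩ ?_).trans
      (binomTail_mean_le_two_thirds (n := n) (ℓ := j + 3) (by omega) hn)
    · rw [div_le_one (by positivity)]; linarith
    · rw [le_div_iff₀ (by positivity)]; push_cast; linarith
  simp only [add_assoc, Nat.reduceAdd] at *
  linarith

/-- A lower bound for the increments of a beta cdf to the right of a point, by log-concavity of
the survival function. -/
lemma binomTail_increment {n ℓ : ℕ} (hℓ : 1 ≤ ℓ) (hn : ℓ ≤ n) {p s δ y : ℝ} (hs : 0 < s)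
    (hps : 0 < p - s) (hδ : 0 < δ) (hpδ : p + δ < 1) (hy : y ≤ 1 / 37) (hy0 : 0 < y)
    (hδs : 270 / 13 * y * s ≤ δ) (h1 : binomTail n ℓ (p - s) ≤ 4 / 29)
    (h2 : 1 / 3 ≤ binomTail n ℓ p) (h3 : binomTail n ℓ p ≤ 4 / 5) :
    binomTail n ℓ p + 3 * y ≤ binomTail n ℓ (p + δ) := by
  -- Reflection gives log-concavity of 1-T: its logarithm falls at least as steeply on [p, p+δ] as
  -- on [p-s, p].
  have hc := (concaveOn_log_binomTail (n := n) (ℓ := n + 1 - ℓ) (by omega)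
    (by omega)).slope_anti_adjacent (x := 1 - (p + δ)) (y := 1 - p) (z := 1 - (p - s))
    ⟨by linarith, by linarith⟩ ⟨by linarith, by linarith⟩ (by linarith) (by linarith)
  simp only [binomTail_one_sub (n := n) (ℓ := ℓ) (by omega)] at hc
  have hlt := binomTail_lt_one hℓ hn (x := p + δ) (by linarith) hpδ
  set S := 1 - binomTail n ℓ p with hS
  set S' := 1 - binomTail n ℓ (p + δ) with hS'
  have hS0 : 1 / 5 ≤ S := by linarith
  have hS1 : S ≤ 2 / 3 := by linarith
  have hS'0 : 0 < S' := by linarith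
  set L := 2 * (25 / 29 - S) / (25 / 29 + S) with hL
  have hlog : L ≤ Real.log (1 - binomTail n ℓ (p - s)) - Real.log S := by
    have e1 := Real.le_log_one_add_of_nonneg (x := (25 / 29 - S) / S)
      (div_nonneg (by linarith) (by linarith))
    have e2 : 1 + (25 / 29 - S) / S = 25 / 29 / S := by field_simp; ring
    have e3 : 2 * ((25 / 29 - S) / S) / ((25 / 29 - S) / S + 2) = L := by
      have : (25 / 29 - S) / S + 2 = (25 / 29 + S) / S := by field_simp; ring
      rw [this, hL]; field_simp
    rw [e2, e3, Real.log_div (by norm_num) (by linarith)] at e1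
    have e4 : Real.log (25 / 29) ≤ Real.log (1 - binomTail n ℓ (p - s)) :=
      Real.log_le_log (by norm_num) (by linarith)
    linarith
  have hL0 : 0 ≤ L := div_nonneg (by linarith) (by linarith)
  set z := 270 / 13 * L with hz
  -- After clearing the denominator this is a concave quadratic inequality in S, hence decided at S
  -- = 1/5 and S = 2/3. The margin is small at both ends; 3/37 is the largest value of 3y.
  have hzS : 3 ≤ z * (S - 3 / 37) := by
    have : z * (S - 3 / 37) = 540 / 13 * (25 / 29 - S) * (S - 3 / 37) / (25 / 29 + S) := by
      rw [hz, hL]; ring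
    rw [this, le_div_iff₀ (by linarith)]
    nlinarith [mul_nonneg (sub_nonneg.2 hS0) (sub_nonneg.2 hS1)]
  have hratio : z * y ≤ Real.log S - Real.log S' := by
    have e1 : 1 - (p - s) - (1 - p) = s := by ring
    have e2 : 1 - p - (1 - (p + δ)) = δ := by ring
    rw [e1, e2, div_le_div_iff₀ hs hδ] at hc
    refine le_of_mul_le_mul_right ?_ hs
    calc z * y * s = L * (270 / 13 * y * s) := by rw [hz]; ring
      _ ≤ L * δ := by gcongr
      _ ≤ (Real.log (1 - binomTail n ℓ (p - s)) - Real.log S) * δ := by gcongr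
      _ ≤ _ := hc
  have hdiv : (1 + z * y) * S' ≤ S := by
    rw [← le_div_iff₀ hS'0]
    have := Real.log_le_sub_one_of_pos (show 0 < S / S' by positivity)
    rw [Real.log_div (by linarith) hS'0.ne'] at this
    linarith
  have hfin : S' ≤ S - 3 * y := by
    have hz0 : 0 ≤ z := by positivity
    refine le_of_mul_le_mul_left (hdiv.trans ?_) (show 0 < 1 + z * y by positivity)
    have : 3 ≤ z * (S - 3 * y) := hzS.trans (by gcongr; linarith)
    nlinarith [mul_le_mul_of_nonneg_right this hy0.le]
  linarith

/-- For large `n` some `Beta(ℓ, n - ℓ + 1)` distribution gives enough mass to the short intervals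
that start at `p`. -/
lemma exists_binomTail_increment {p : ℝ} (hp : p ∈ Set.Ioo (0 : ℝ) 1) :
    ∃ n₀ : ℕ, 1 ≤ n₀ ∧ ∀ n : ℕ, n₀ ≤ n → ∃ ℓ : ℕ, 1 ≤ ℓ ∧ ℓ ≤ n ∧ binomTail n ℓ p ≤ 4 / 5 ∧
      ∀ y : ℝ, 0 < y → y ≤ 1 / 37 → p + 27 * y / √((n : ℝ) + 2) < 1 ∧
        binomTail n ℓ p + 3 * y ≤ binomTail n ℓ (p + 27 * y / √((n : ℝ) + 2)) := by
  have hq : 0 < 1 - p := by linarith [hp.2]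
  have hp0 := hp.1
  set R := p * (1 - p) with hR
  have hR0 : 0 < R := mul_pos hp0 hq
  have hRp : R ≤ p := by nlinarith
  have hRq : R ≤ 1 - p := by nlinarith
  have hR1 : R ≤ 1 := by linarith
  -- The first summand gives (n+1)R ≥ 20 and √(n+2) R ≥ 2; 1000 gives √(n+2) ≥ 31, used for s√(n+2)
  -- ≤ 13/10.
  refine ⟨⌈20 / R ^ 2⌉₊ + 1000, by omega, fun n hn => ?_⟩
  have hn1 : (1000 : ℝ) ≤ n := by exact_mod_cast (by omega : 1000 ≤ n)
  have hn2 : 20 / R ^ 2 ≤ n := (Nat.le_ceil _).trans (by exact_mod_cast (by omega))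
  rw [div_le_iff₀ (by positivity)] at hn2
  set N := √((n : ℝ) + 2) with hN
  have hN0 : 0 < N := Real.sqrt_pos.2 (by linarith)
  have hNsq : N ^ 2 = n + 2 := Real.sq_sqrt (by linarith)
  have hNR : 2 ≤ N * R := by
    refine le_of_sq_le_sq ?_ (by positivity)
    rw [mul_pow, hNsq]; nlinarith [sq_nonneg R]
  have hbig : 20 ≤ ((n : ℝ) + 1) * R := by nlinarith [mul_nonneg hR0.le (sub_nonneg.2 hR1)]
  set ℓ := ⌊((n : ℝ) + 1) * p⌋₊ with hℓ
  have hℓ1 : ((n : ℝ) + 1) * p - 1 < ℓ := Nat.sub_one_lt_floor _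
  have hℓ2 : (ℓ : ℝ) ≤ ((n : ℝ) + 1) * p := Nat.floor_le (by positivity)
  have h2 : 2 ≤ ℓ := Nat.le_floor (by push_cast; nlinarith)
  have hℓn : ℓ + 1 ≤ n := by
    have : (ℓ : ℝ) + 1 ≤ n := by nlinarith
    exact_mod_cast this
  have hT := binomTail_le_four_fifths hp h2 hℓn hℓ1 hbig
  have hT3 : 1 / 3 ≤ binomTail n ℓ p := by
    refine (one_third_le_binomTail_mean (by omega) (by omega)).trans
      (monotoneOn_binomTail (by omega) ⟨by positivity, ?_⟩ ⟨hp.1.le, hp.2.le⟩ ?_)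
    · rw [div_le_one (by positivity)]; nlinarith
    · rw [div_le_iff₀ (by positivity)]; linarith
  refine ⟨ℓ, by omega, by omega, hT, fun y hy0 hy => ?_⟩
  -- The +1 absorbs the floor in ℓ, so that n(p-s) + (5/4)√n ≤ ℓ. Cantelli then gives (1/4)/(1/4 +
  -- 25/16) = 4/29.
  set s := (5 / 4 * √(n : ℝ) + 1) / n with hs
  have hr := Real.sq_sqrt (show (0 : ℝ) ≤ n by linarith)
  have hr0 := Real.sqrt_nonneg (n : ℝ)
  have hn0 : (0 : ℝ) < n := by linarith
  have hsn : s * n = 5 / 4 * √(n : ℝ) + 1 := by rw [hs]; field_simp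
  have hs0 : 0 < s := by positivity
  have hsN : s * N ≤ 13 / 10 := by
    have h31 : 31 ≤ N := Real.le_sqrt_of_sq_le (by linarith)
    have e1 : √(n : ℝ) * N ≤ n + 1 := by nlinarith [sq_nonneg (√(n : ℝ) - N)]
    have e2 : 31 * N ≤ n + 2 := by nlinarith
    have e3 : s * N = (5 / 4 * (√(n : ℝ) * N) + N) / n := by rw [hs]; ring
    rw [e3, div_le_iff₀ hn0]
    linarith
  have hNp : 2 ≤ N * p := hNR.trans (by gcongr)
  have hNq : 2 ≤ N * (1 - p) := hNR.trans (by gcongr)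
  have hps : 0 < p - s := by
    refine pos_of_mul_pos_right (a := N) ?_ hN0.le
    linarith
  have hpδ : p + 27 * y / N < 1 := by
    have : 27 * y / N < 1 - p := by
      rw [div_lt_iff₀ hN0]; linarith
    linarith
  refine ⟨hpδ, binomTail_increment (by omega) (by omega) hs0 hps (by positivity) hpδ hy hy0 ?_ ?_
    hT3 hT⟩
  -- Here 27 = (270/13)(13/10) meets the bound on s√(n+2).
  · rw [le_div_iff₀ hN0]
    nlinarith
  · have hcan := binomTail_cantelli (n := n) (ℓ := ℓ) (x := p - s) (t := 5 / 4 * √(n : ℝ))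
      ⟨hps.le, by linarith⟩ (by positivity) (by linarith)
    rw [mul_pow, hr] at hcan
    have : (n : ℝ) * binomTail n ℓ (p - s) ≤ n * (4 / 29) := by linarith
    exact le_of_mul_le_mul_left this hn0

/-! ### Rounding and the candidate sets -/

lemma le_kTilde {m n ℓ : ℕ} {α : ℝ} (hα : α ∈ Set.Ioo (0 : ℝ) 1) (hℓ : 1 ≤ ℓ) (hn : ℓ ≤ n) :
    ((m : ℝ) + 1 / 2) * binomTail n ℓ (1 - α) + 1 / 2 ≤ kTilde m n ℓ α := by
  rw [← F_eq_binomTail hℓ hn ⟨by linarith [hα.2], by linarith [hα.1]⟩]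
  exact Nat.le_ceil _

lemma kTilde_lt {m n ℓ : ℕ} {α : ℝ} (hα : α ∈ Set.Ioo (0 : ℝ) 1) (hℓ : 1 ≤ ℓ) (hn : ℓ ≤ n) :
    (kTilde m n ℓ α : ℝ) < ((m : ℝ) + 1 / 2) * binomTail n ℓ (1 - α) + 3 / 2 := by
  have h0 : 0 < 1 - α := by linarith [hα.2]
  have h1 : 1 - α < 1 := by linarith [hα.1]
  have := binomTail_nonneg n ℓ h0.le h1.le
  rw [kTilde, F_eq_binomTail hℓ hn ⟨h0, h1⟩]
  refine (Nat.ceil_lt_add_one (by positivity)).trans_le (by linarith)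

lemma mem_qqmCandidates_of_mem_qqmFastCandidates {m n ℓ : ℕ} {α : ℝ}
    (hα : α ∈ Set.Ioo (0 : ℝ) 1) (h : ℓ ∈ qqmFastCandidates m n α) :
    (ℓ, kTilde m n ℓ α) ∈ qqmCandidates m n α := by
  obtain ⟨hℓ, hk⟩ := h
  refine ⟨hℓ, hk, ?_⟩
  rw [mem_Icc] at hℓ hk
  exact le_M hℓ.1 hℓ.2 hk.1 hk.2 ⟨by linarith [hα.2], by linarith [hα.1]⟩
    (by linarith [le_kTilde (m := m) hα hℓ.1 hℓ.2])

end QQ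

theorem mainTheorem4 (α : ℝ) (hα : α ∈ Set.Ioo (0 : ℝ) 1) :
    ∃ n₀ : ℕ, 1 ≤ n₀ ∧ ∀ n m : ℕ, n₀ ≤ n → 18 ≤ m →
      (∃ ℓ k : ℕ, QQ.IsQQM m n α ℓ k) ∧
      (∃ ℓ k : ℕ, QQ.IsQQMFast m n α ℓ k) ∧
      ∀ ℓs ks ℓt kt : ℕ, QQ.IsQQM m n α ℓs ks → QQ.IsQQMFast m n α ℓt kt →
        1 - α ≤ QQ.M m n ℓs ks ∧
        QQ.M m n ℓs ks ≤ QQ.M m n ℓt kt ∧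
        QQ.M m n ℓt kt ≤ 1 - α + 27 / ((2 * (m : ℝ) + 1) * Real.sqrt ((n : ℝ) + 2)) := by
  have hp : 1 - α ∈ Set.Ioo (0 : ℝ) 1 := ⟨by linarith [hα.2], by linarith [hα.1]⟩
  obtain ⟨n₀, hn₀, hinc⟩ := QQ.exists_binomTail_increment hp
  refine ⟨n₀, hn₀, fun n m hn hm => ?_⟩
  obtain ⟨ℓ, hℓ, hℓn, hT, hδ⟩ := hinc n hn
  have hm' : (18 : ℝ) ≤ m := by exact_mod_cast hm
  -- The condition 1/(2m+1) ≤ 1/37 is exactly m ≥ 18.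
  obtain ⟨hlt, hle⟩ := hδ (1 / (2 * m + 1)) (by positivity)
    (one_div_le_one_div_of_le (by norm_num) (by linarith))
  set x := 1 - α + 27 * (1 / (2 * (m : ℝ) + 1)) / √((n : ℝ) + 2) with hx
  have hxe : 1 - α + 27 / ((2 * (m : ℝ) + 1) * √((n : ℝ) + 2)) = x := by
    rw [hx, mul_one_div, div_div]
  have hxmem : x ∈ Set.Ioo (0 : ℝ) 1 := ⟨add_pos_of_pos_of_nonneg hp.1 (by positivity), hlt⟩
  have hfast : ℓ ∈ QQ.qqmFastCandidates m n α := by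
    refine ⟨Finset.mem_Icc.2 ⟨hℓ, hℓn⟩, Finset.mem_Icc.2 ⟨?_, ?_⟩⟩
    · have h1 := QQ.le_kTilde (m := m) hα hℓ hℓn
      have h2 := QQ.binomTail_nonneg n ℓ hp.1.le hp.2.le
      have h3 : (0 : ℝ) < QQ.kTilde m n ℓ α := lt_of_lt_of_le (by positivity) h1
      exact_mod_cast h3
    -- As T(1-α) ≤ 4/5, the ceiling stays at most m: (4/5)(m+1/2) + 1/2 ≤ m.
    · have hF := QQ.F_eq_binomTail hℓ hℓn hp
      rw [QQ.kTilde, hF, Nat.ceil_le]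
      nlinarith
  have hfin : (QQ.qqmFastCandidates m n α).Finite :=
    (Finset.finite_toSet (Finset.Icc 1 n)).subset fun l hl => hl.1
  have hfin' : (QQ.qqmCandidates m n α).Finite :=
    (Finset.finite_toSet (Finset.Icc 1 n ×ˢ Finset.Icc 1 m)).subset fun q hq => by
      exact Finset.mem_coe.2 (Finset.mem_product.2 ⟨hq.1, hq.2.1⟩)
  refine ⟨?_, ?_, ?_⟩
  · obtain ⟨q, hq, hmin⟩ := Set.exists_min_image _ (fun q : ℕ × ℕ => QQ.M m n q.1 q.2) hfin'
      ⟨_, QQ.mem_qqmCandidates_of_mem_qqmFastCandidates hα hfast⟩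
    exact ⟨q.1, q.2, hq, hmin⟩
  · obtain ⟨l, hl, hmin⟩ := Set.exists_min_image _
      (fun l : ℕ => QQ.Finv n l ((QQ.kTilde m n l α : ℝ) / ((m : ℝ) + 1 / 2))) hfin ⟨ℓ, hfast⟩
    exact ⟨l, _, hl, hmin, rfl⟩
  · rintro ℓs ks ℓt kt ⟨hs, hsmin⟩ ⟨ht, htmin, rfl⟩
    refine ⟨hs.2.2, hsmin (QQ.mem_qqmCandidates_of_mem_qqmFastCandidates hα ht), ?_⟩
    have ht1 := Finset.mem_Icc.1 ht.1
    have ht2 := Finset.mem_Icc.1 ht.2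
    have hk1 := Finset.mem_Icc.1 hfast.2
    have hq0 : (0 : ℝ) < (QQ.kTilde m n ℓ α : ℝ) / ((m : ℝ) + 1 / 2) := by
      have : (1 : ℝ) ≤ QQ.kTilde m n ℓ α := by exact_mod_cast hk1.1
      positivity
    rw [hxe]
    -- The mean is at most its own objective, which by minimality is at most the objective of the
    -- special ℓ, which is at most x.
    refine (QQ.M_le_Finv ht1.1 ht1.2 ht2.1 ht2.2).trans
      ((htmin hfast).trans (QQ.Finv_le hℓ hℓn hq0 hxmem (le_trans ?_ hle)))
    rw [div_le_iff₀ (by positivity)]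
    have h1 := QQ.kTilde_lt (m := m) hα hℓ hℓn
    have h2 : 3 * (1 / (2 * (m : ℝ) + 1)) * ((m : ℝ) + 1 / 2) = 3 / 2 := by field_simp
    linarith
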